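/- Let $A$ be a finite alphabet. A configuration is an element of $A^{\mathbb Z}$; a (one-dimensional) subshift is a closed, shift-invariant subset $S\subseteq A^{\mathbb Z}$ (product of discrete topologies), and its elements are its points. A pattern is a map $p:P\to A$ with $P\subset\mathbb Z$ finite; it appears in $x\in A^{\mathbb Z}$ if for some $z\in\mathbb Z$ we have $x_{z+i}=p_i$ for all $i\in P$. The subshift $S$ is effective if there is a computably enumerable (equivalently, a computable) set $\mathcal F$ of patterns such that $S$ is the set of all configurations in which no pattern of $\mathcal F$ appears. A subshift is minimal if it is non-empty and contains no proper non-empty subshift. The language of a subshift is the set of finite words over $A$ that appear in some point of it. Turing degrees are those of infinite binary sequences (equivalently, of sets of natural numbers), transferred to words, integers and configurations $\mathbb Z\to A$ through standard codings; $0'$ is the degree of the halting problem. Let $S\subseteq A^{\mathbb Z}$ be a non-empty effective subshift. Then: 1. $S$ contains a minimal subshift $\tilde S\subseteq S$ whose language is of Turing degree less than or equal to $0'$. 2. If no point of $S$ is computable, then for every Turing degree $d\ge 0'$ there is a point $x\in S$ of Turing degree exactly $d$. -/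

import Mathlib

open SymbolicDynamics.FullShift

namespace EffSubshift

/-- The partial function on codes that represents a total function `f` between coded types: it maps
the code of `a` to the code of `f a`. -/
def codeFun {α σ : Type*} [Primcodable α] [Primcodable σ] (f : α → σ) : ℕ →. ℕ :=
  fun n => (Encodable.decode (α := α) n : Part α).bind fun a => Part.some (Encodable.encode (f a))

/-- The Turing degree of a total function between coded types. -/
def degree {α σ : Type*} [Primcodable α] [Primcodable σ] (f : α → σ) : TuringDegree :=
  toAntisymmetrization TuringReducible (codeFun f)

open Classical in
/-- The Turing degree of a set, that is, of its characteristic function. -/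
noncomputable def setDegree {α : Type*} [Primcodable α] (s : Set α) : TuringDegree :=
  degree (fun a : α => decide (a ∈ s))

/-- The degree `0'` of the halting problem "does program `c` halt on input `n`?". -/
noncomputable def zeroJump : TuringDegree :=
  setDegree {p : Nat.Partrec.Code × ℕ | (p.1.eval p.2).Dom}

/-- The order on degrees is relative computability. -/
theorem degree_le_degree {α β σ τ : Type*} [Primcodable α] [Primcodable β] [Primcodable σ]
    [Primcodable τ] (f : α → σ) (g : β → τ) :
    degree f ≤ degree g ↔ ComputableIn {codeFun g} f := by
  refine Iff.trans (b := TuringReducible (codeFun f) (codeFun g)) Iff.rfl ?_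
  exact RecursiveIn.iff_nat

/-- Equality of degrees is computability in each other. -/
theorem degree_eq_degree {α β σ τ : Type*} [Primcodable α] [Primcodable β] [Primcodable σ]
    [Primcodable τ] (f : α → σ) (g : β → τ) :
    degree f = degree g ↔ ComputableIn {codeFun g} f ∧ ComputableIn {codeFun f} g := by
  rw [le_antisymm_iff, degree_le_degree, degree_le_degree]

/-- A pattern `P → A`, with `P` a finite subset of `ℤ`, is given by the finite list of the pairs
`(position, letter)` of its graph. It appears in `x` at `z` when `x` has the prescribed letters at
the positions shifted by `z`. (A list that gives two letters to one position appears nowhere, so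
that it makes no difference whether it is forbidden.) -/
def PatternAt {A : Type*} (p : List (ℤ × A)) (x : ℤ → A) (z : ℤ) : Prop :=
  ∀ q ∈ p, x (z + q.1) = q.2

/-- The configurations in which no pattern of `F` appears anywhere. -/
def avoiding {A : Type*} (F : Set (List (ℤ × A))) : Set (ℤ → A) :=
  {x | ∀ p ∈ F, ∀ z : ℤ, ¬ PatternAt p x z}

/-- A subshift is effective if it is defined by a computably enumerable set of forbidden
patterns. -/
def IsEffective {A : Type*} [TopologicalSpace A] [Primcodable A] (S : Subshift A ℤ) : Prop :=
  ∃ F : Set (List (ℤ × A)), REPred (fun p => p ∈ F) ∧ S.carrier = avoiding F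

/-- A computable set of forbidden patterns defines an effective subshift. -/
theorem IsEffective.of_computablePred {A : Type*} [TopologicalSpace A] [Primcodable A]
    {S : Subshift A ℤ} {F : Set (List (ℤ × A))} (hF : ComputablePred (fun p => p ∈ F))
    (hS : S.carrier = avoiding F) : IsEffective S :=
  ⟨F, hF.to_re, hS⟩

/-- A subshift is minimal if it is non-empty and contains no proper non-empty subshift. -/
def IsMinimal {A : Type*} [TopologicalSpace A] (S : Subshift A ℤ) : Prop :=
  S.carrier.Nonempty ∧
    ∀ T : Subshift A ℤ, T.carrier.Nonempty → T.carrier ⊆ S.carrier → T.carrier = S.carrier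

/-- The language of a subshift: the words that appear in some point of it. -/
def language {A : Type*} [TopologicalSpace A] (S : Subshift A ℤ) : Set (List A) :=
  {w | ∃ x ∈ S.carrier, ∃ z : ℤ, ∀ (i : ℕ) (hi : i < w.length), x (z + i) = w[i]}

end EffSubshift

/-! Part 1. By compactness, a set of forbidden patterns leaves no configuration exactly when
finitely many placed patterns already meet every word on some window `[-n, n)`
(`avoiding_eq_empty_iff`). For an effective subshift, emptiness after forbidding finitely many
further patterns is therefore semidecidable, hence decidable from `0'`. Run through all patterns and
forbid each one unless this would empty the subshift. The limit is non-empty by compactness, and a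
pattern that was not forbidden occurs in every point of it. So the limit is minimal, and a word is
in its language exactly when the oracle refused to forbid it (`exists_minimal_language_le`).

Part 2. Let `T` be this minimal subshift; it has no computable point. Given a word on `[-R, R)`,
recurrence produces a translate that shows the word again. The two copies must differ somewhere
further right, for otherwise the point is periodic to the right and `T` contains a periodic, hence
computable, point. At the first difference one of the two letters is smaller, and this order codes a
bit. Both bits are available: the translate lies in the same cylinder, so in the lexicographically
least point the original letter is the smaller one, and in the greatest point the larger one
(`IsMinimal.exists_mismatch_order`).

Coding the bits of `s` one after the other gives nested words whose limit is a point `y` of `T`. A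
search through the language, which `s` decides, computes `y`. Conversely `y` determines its first
mismatch at every radius, so it retraces the construction and reads off `s`
(`IsMinimal.exists_degree_eq`). -/

open Encodable

/-! ### Closure properties of computability relative to oracles. -/

section Oracle

variable {α β γ σ : Type*} [Primcodable α] [Primcodable β] [Primcodable γ] [Primcodable σ]
variable {O : Set (ℕ →. ℕ)}

theorem RecursiveIn.comp {f : β →. σ} {g : α → β} (hf : RecursiveIn O f)
    (hg : ComputableIn O g) : RecursiveIn O fun a => f (g a) :=
  (Nat.RecursiveIn.comp hf hg).of_eq fun n => by
    simp only [Part.map_some, Part.bind_eq_bind]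
    rcases e : decode (α := α) n with - | a <;> simp [encodek]

theorem ComputableIn.of_eq {f g : α → σ} (hf : ComputableIn O f) (H : ∀ a, f a = g a) :
    ComputableIn O g :=
  (funext H : f = g) ▸ hf

theorem ComputableIn.comp {f : β → σ} {g : α → β} (hf : ComputableIn O f)
    (hg : ComputableIn O g) : ComputableIn O fun a => f (g a) :=
  RecursiveIn.comp (f := fun b => Part.some (f b)) hf hg

theorem ComputableIn.pair {f : α → β} {g : α → γ} (hf : ComputableIn O f)
    (hg : ComputableIn O g) : ComputableIn O fun a => (f a, g a) :=
  (Nat.RecursiveIn.pair hf hg).of_eq fun n => by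
    rcases e : decode (α := α) n with - | a <;> simp [Seq.seq]

theorem ComputableIn.nat_rec {f : α → ℕ} {g : α → σ} {h : α → ℕ × σ → σ} (hf : ComputableIn O f)
    (hg : ComputableIn O g) (hh : ComputableIn₂ O h) :
    ComputableIn O fun a => Nat.rec (motive := fun _ => σ) (g a) (fun y IH => h a (y, IH)) (f a) := by
  have key := Nat.RecursiveIn.comp (Nat.RecursiveIn.prec hg hh)
    (Nat.RecursiveIn.pair (Nat.Partrec.some.recursiveIn (O := O)) hf)
  refine key.of_eq fun n => ?_
  rcases e : decode (α := α) n with - | a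
  · simp [Seq.seq]
  · simp only [e, Seq.seq, Part.coe_some, Part.bind_some, Part.map_some, Part.bind_eq_bind,
      Part.map_eq_map, Nat.unpair_pair, encode_nat]
    induction f a with
    | zero => simp [e]
    | succ k ih => simp only [ih]; simp [e, encodek]

theorem RecursiveIn.rfind {p : α → ℕ → Bool} (hp : ComputableIn₂ O p) :
    RecursiveIn O fun a => Nat.rfind fun n => Part.some (p a n) := by
  -- The `Nat.RecursiveIn` search looks for a zero, so `true` becomes `0`.
  have h1 : ComputableIn O fun q : α × ℕ => cond (p q.1 q.2) 0 1 :=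
    ComputableIn.comp (f := fun b => cond b 0 1) (Primrec.dom_bool _).computableIn hp
  refine (Nat.RecursiveIn.rfind h1).of_eq fun n => ?_
  rcases e : decode (α := α) n with - | a
  · simpa [e] using Nat.rfind_zero_none _ rfl
  · simp only [Nat.unpair_pair, decode_prod_val, e, Part.coe_some, Part.bind_some, Part.map_some,
      Option.bind_some, decode_nat, Option.map_some, encode_nat, Part.map_eq_map]
    congr 1
    funext k
    cases p a k <;> simp

theorem ComputableIn.cond {c : α → Bool} {f g : α → σ} (hc : ComputableIn O c)
    (hf : ComputableIn O f) (hg : ComputableIn O g) :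
    ComputableIn O fun a => cond (c a) (f a) (g a) :=
  (ComputableIn.comp (f := fun p : Bool × σ × σ => bif p.1 then p.2.1 else p.2.2)
    (Primrec.cond Primrec.fst (Primrec.fst.comp Primrec.snd)
      (Primrec.snd.comp Primrec.snd)).computableIn (hc.pair (hf.pair hg)))

open Classical in
/-- Unbounded search relative to an oracle. -/
theorem ComputableIn.exists_choice [Inhabited β] {P : α → β → Prop}
    (hP : ComputableIn O fun p : α × β => decide (P p.1 p.2)) (h : ∀ a, ∃ b, P a b) :
    ∃ g : α → β, ComputableIn O g ∧ ∀ a, P a (g a) := by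
  let D : ℕ → β := fun n => (decode n).getD default
  have hD : Primrec D :=
    Primrec.option_getD.comp Primrec.decode (Primrec.const _)
  have hp : ComputableIn₂ O fun (a : α) (n : ℕ) => decide (P a (D n)) :=
    ComputableIn.comp (f := fun p : α × β => decide (P p.1 p.2)) (g := fun q : α × ℕ => (q.1, D q.2))
      hP (Primrec.fst.pair (hD.comp Primrec.snd)).computableIn
  have hex : ∀ a, ∃ n, P a (D n) := fun a => by
    obtain ⟨b, hb⟩ := h a
    exact ⟨encode b, by simpa [D, encodek] using hb⟩
  refine ⟨fun a => D (Nat.find (hex a)), ?_, fun a => Nat.find_spec (hex a)⟩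
  refine ComputableIn.comp (f := D) hD.computableIn ?_
  refine (RecursiveIn.rfind hp).of_eq_tot fun a => ?_
  refine Nat.mem_rfind.2 ⟨?_, fun {m} hm => ?_⟩
  · simpa using Nat.find_spec (hex a)
  · simpa using Nat.find_min (hex a) hm

end Oracle

namespace EffSubshift

/-! ### Semidecidable predicates and the halting problem. -/

section RE

variable {α β : Type*} [Primcodable α] [Primcodable β]

/-- Kleene normal form: the stage bounds the run of a program that semidecides `p`. -/
theorem exists_primrec_stage_of_rePred {p : α → Prop} (hp : REPred p) :
    ∃ f : α × ℕ → Bool, Primrec f ∧ ∀ a, p a ↔ ∃ n, f (a, n) = true := by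
  obtain ⟨c, hc⟩ := Nat.Partrec.Code.exists_code.1 hp
  refine ⟨fun q => (Nat.Partrec.Code.evaln q.2 c (encode q.1)).isSome, ?_, fun a => ?_⟩
  · exact Primrec.option_isSome.comp (Nat.Partrec.Code.primrec_evaln.comp
      ((Primrec.snd.pair (Primrec.const c)).pair (Primrec.encode.comp Primrec.fst)))
  · have h1 : p a ↔ (c.eval (encode a)).Dom := by
      rw [hc]; simp [encodek, Part.assert]
    rw [h1, Part.dom_iff_mem]
    simp only [Nat.Partrec.Code.evaln_complete, Option.isSome_iff_exists, Option.mem_def]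
    exact exists_comm

theorem rePred_exists_of_primrecRel {R : α → β → Prop} (hR : PrimrecRel R) :
    REPred fun a => ∃ b, R a b := by
  classical
  have h1 : Primrec fun q : α × ℕ => ((decode (α := β) q.2).map
      fun b => decide (R q.1 b)).getD false :=
    Primrec.option_getD.comp (Primrec.option_map (Primrec.decode.comp Primrec.snd)
      ((PrimrecRel.decide hR).comp (Primrec.fst.comp Primrec.fst) Primrec.snd).to₂) (Primrec.const _)
  have h2 := (Partrec.rfind (p := fun (a : α) (n : ℕ) =>
    Part.some (((decode (α := β) n).map fun b => decide (R a b)).getD false)) h1.to_comp).dom_re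
  refine h2.of_eq fun a => ?_
  refine Nat.rfind_dom.trans ?_
  constructor
  · rintro ⟨n, hn, -⟩
    rcases e : decode (α := β) n with - | b
    · simp [e] at hn
    · exact ⟨b, by simpa [e] using hn⟩
  · rintro ⟨b, hb⟩
    exact ⟨encode b, by simpa [encodek] using hb, fun _ => trivial⟩

/-- Computably enumerable predicates are decidable relative to the halting problem. -/
theorem setDegree_le_zeroJump_of_rePred {s : Set α} (hs : REPred fun a => a ∈ s) :
    setDegree s ≤ zeroJump := by
  classical
  obtain ⟨c, hc⟩ := Nat.Partrec.Code.exists_code.1 hs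
  refine (degree_le_degree _ _).2 ?_
  have h0 := (degree_le_degree
    (fun a : Nat.Partrec.Code × ℕ => decide (a ∈ {p : Nat.Partrec.Code × ℕ | (p.1.eval p.2).Dom}))
    (fun a : Nat.Partrec.Code × ℕ => decide (a ∈ {p : Nat.Partrec.Code × ℕ | (p.1.eval p.2).Dom}))).1
    le_rfl
  refine (ComputableIn.comp (g := fun a : α => (c, encode a)) h0
    ((Primrec.const c).pair Primrec.encode).computableIn).of_eq fun a => ?_
  have h1 : a ∈ s ↔ (c.eval (encode a)).Dom := by
    rw [hc]; simp [encodek, Part.assert]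
  simp [h1]

end RE

/-! ### Primitive recursive integer arithmetic. -/

section IntPrimrec

variable {α : Type*} [Primcodable α]

theorem primrec_natCast_int : Primrec (fun n : ℕ => (n : ℤ)) :=
  Primrec.encode_iff.1 <| (Primrec.nat_mul.comp (Primrec.const 2) Primrec.id).of_eq fun _ => rfl

theorem primrec_negSucc : Primrec Int.negSucc :=
  Primrec.encode_iff.1 <| (Primrec.succ.comp
    (Primrec.nat_mul.comp (Primrec.const 2) Primrec.id)).of_eq fun _ => rfl

theorem encode_natCast_int (n : ℕ) : encode (n : ℤ) = 2 * n := rfl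

theorem encode_negSucc (n : ℕ) : encode (Int.negSucc n) = 2 * n + 1 := rfl

theorem primrec_int_toNat : Primrec Int.toNat := by
  refine (Primrec.ite (c := fun z : ℤ => (encode z) % 2 = 0)
    (Primrec.eq.comp (Primrec.nat_mod.comp Primrec.encode (Primrec.const 2)) (Primrec.const 0))
    (Primrec.nat_div.comp Primrec.encode (Primrec.const 2)) (Primrec.const 0)).of_eq fun z => ?_
  rcases z with n | n
  · simp [encode_natCast_int]
  · rw [encode_negSucc, if_neg (by omega)]; rfl

theorem primrec_int_neg_toNat : Primrec fun z : ℤ => (-z).toNat := by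
  refine (Primrec.ite (c := fun z : ℤ => (encode z) % 2 = 0)
    (Primrec.eq.comp (Primrec.nat_mod.comp Primrec.encode (Primrec.const 2)) (Primrec.const 0))
    (Primrec.const 0)
    (Primrec.succ.comp (Primrec.nat_div.comp Primrec.encode (Primrec.const 2)))).of_eq fun z => ?_
  rcases z with n | n
  · simp [encode_natCast_int]
  · rw [encode_negSucc, if_neg (by omega), Int.neg_negSucc]; simp; omega

theorem primrec_natCast_sub_natCast : Primrec₂ fun a b : ℕ => (a : ℤ) - b := by
  refine (Primrec.ite (c := fun q : ℕ × ℕ => q.2 ≤ q.1) (Primrec.nat_le.comp Primrec.snd Primrec.fst)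
    (primrec_natCast_int.comp (Primrec.nat_sub.comp Primrec.fst Primrec.snd))
    (primrec_negSucc.comp (Primrec.pred.comp (Primrec.nat_sub.comp Primrec.snd Primrec.fst)))).of_eq
    fun q => ?_
  simp only [Int.negSucc_eq, Nat.pred_eq_sub_one]
  split_ifs <;> omega

/-- Positive and negative parts are added separately, then subtracted. -/
theorem primrec_int_add : Primrec₂ fun a b : ℤ => a + b := by
  refine (primrec_natCast_sub_natCast.comp
    (Primrec.nat_add.comp (primrec_int_toNat.comp (Primrec.fst (α := ℤ) (β := ℤ)))
      (primrec_int_toNat.comp Primrec.snd))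
    (Primrec.nat_add.comp (primrec_int_neg_toNat.comp Primrec.fst)
      (primrec_int_neg_toNat.comp Primrec.snd))).of_eq fun q => ?_
  rcases q with ⟨a, b⟩
  simp only [Nat.cast_add]
  omega

end IntPrimrec

/-! ### Words and their patterns. -/

section Words

variable {A : Type*}

/-- The word of length `n` that `x` shows from position `a` on. -/
def word (x : ℤ → A) (a : ℤ) (n : ℕ) : List A :=
  (List.range n).map fun j : ℕ => x (a + j)

@[simp]
theorem length_word (x : ℤ → A) (a : ℤ) (n : ℕ) : (word x a n).length = n := by
  simp [word]

theorem getElem?_word (x : ℤ → A) (a : ℤ) {n i : ℕ} (h : i < n) :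
    (word x a n)[i]? = some (x (a + i)) := by
  simp [word, h]

theorem word_eq_iff {x y : ℤ → A} {a b : ℤ} {n : ℕ} :
    word x a n = word y b n ↔ ∀ j < n, x (a + j) = y (b + j) := by
  simp [word]

/-- All words of a given length. -/
def allWords (l : List A) (n : ℕ) : List (List A) :=
  Nat.rec [[]] (fun _ W => W.flatMap fun w => l.map fun a => a :: w) n

theorem mem_allWords {l : List A} (hl : ∀ a, a ∈ l) {n : ℕ} {w : List A} :
    w ∈ allWords l n ↔ w.length = n := by
  induction n generalizing w with
  | zero => simp [allWords]
  | succ n ih =>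
    have : allWords l (n + 1) = (allWords l n).flatMap fun w => l.map fun a => a :: w := rfl
    rw [this]
    cases w with
    | nil => simp
    | cons a w => simp [ih, hl]

theorem primrec_allWords [Primcodable A] (l : List A) : Primrec (allWords l) := by
  have h : Primrec₂ fun (_ : ℕ) (W : List (List A)) =>
      W.flatMap fun w => l.map fun a => a :: w := by
    refine Primrec.list_flatMap Primrec.snd ?_
    exact Primrec.list_map (Primrec.const l)
      (Primrec.list_cons.comp Primrec.snd (Primrec.snd.comp Primrec.fst)).to₂
  exact Primrec.nat_rec₁ [[]] h

/-- The pattern that a word describes. -/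
def wordPattern (w : List A) : List (ℤ × A) :=
  (List.range w.length).filterMap fun i : ℕ => w[i]?.map fun a => ((i : ℤ), a)

theorem patternAt_wordPattern {w : List A} {x : ℤ → A} {z : ℤ} :
    PatternAt (wordPattern w) x z ↔ ∀ (i : ℕ) (hi : i < w.length), x (z + i) = w[i] := by
  constructor
  · intro h i hi
    exact h ((i : ℤ), w[i]) (List.mem_filterMap.2 ⟨i, by simpa using hi, by simp [hi]⟩)
  · intro h q hq
    simp only [wordPattern, List.mem_filterMap, List.mem_range, Option.map_eq_some_iff] at hq
    obtain ⟨i, hi, a, ha, rfl⟩ := hq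
    rw [h i hi]
    simpa [hi] using ha

theorem primrec_wordPattern [Primcodable A] : Primrec (wordPattern (A := A)) := by
  refine Primrec.listFilterMap (Primrec.list_range.comp Primrec.list_length) ?_
  exact Primrec.option_map Primrec.list_getElem?
    ((primrec_natCast_int.comp (Primrec.snd.comp Primrec.fst)).pair Primrec.snd).to₂

end Words

/-! ### Compactness and semidecidability of emptiness. -/

section Emptiness

variable {A : Type*}

/-- The word `u`, placed on `[-n, n)`, shows the pattern `p` at `z`. -/
def PatternInWord (n : ℕ) (u : List A) (p : List (ℤ × A)) (z : ℤ) : Prop :=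
  ∀ q ∈ p, (-(z + q.1 + n)).toNat = 0 ∧ u[(z + q.1 + n).toNat]? = some q.2

/-- The sign clause excludes positions left of the window, which `toNat` would send to `0`;
positions right of it fail the lookup. -/
theorem PatternInWord.patternAt {n : ℕ} {x : ℤ → A} {p : List (ℤ × A)} {z : ℤ}
    (h : PatternInWord n (word x (-n) (2 * n)) p z) : PatternAt p x z := by
  intro q hq
  obtain ⟨h1, h2⟩ := h q hq
  have h3 : (z + q.1 + n).toNat < 2 * n := by
    by_contra h4
    rw [List.getElem?_eq_none (by simpa using h4)] at h2
    cases h2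
  rw [getElem?_word _ _ h3] at h2
  simp only [Option.some_inj] at h2
  rw [← h2]
  congr 1
  omega

theorem PatternAt.patternInWord [Inhabited A] {n : ℕ} {u : List A} (hu : u.length = 2 * n)
    {p : List (ℤ × A)} {z : ℤ} (hp : ∀ q ∈ p, (z + q.1).natAbs < n)
    (h : PatternAt p (fun t => u.getD (t + n).toNat default) z) : PatternInWord n u p z := by
  intro q hq
  have h1 := hp q hq
  have h2 := h q hq
  refine ⟨by omega, ?_⟩
  have h3 : (z + q.1 + n).toNat < u.length := by omega
  simp only [List.getD_eq_getElem?_getD, List.getElem?_eq_getElem h3, Option.getD_some] at h2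
  rw [List.getElem?_eq_getElem h3, h2]

theorem primrec_patternInWord [Primcodable A] :
    PrimrecRel fun (g : List (ℤ × A) × ℤ) (b : ℕ × List A) => PatternInWord b.1 b.2 g.1 g.2 := by
  have key : PrimrecRel fun (q : ℤ × A) (b : ℤ × ℕ × List A) =>
      (-(b.1 + q.1 + b.2.1)).toNat = 0 ∧ b.2.2[(b.1 + q.1 + b.2.1).toNat]? = some q.2 := by
    have hi : Primrec fun v : (ℤ × A) × (ℤ × ℕ × List A) => v.2.1 + v.1.1 + (v.2.2.1 : ℤ) :=
      primrec_int_add.comp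
        (primrec_int_add.comp (Primrec.fst.comp Primrec.snd) (Primrec.fst.comp Primrec.fst))
        (primrec_natCast_int.comp (Primrec.fst.comp (Primrec.snd.comp Primrec.snd)))
    refine PrimrecPred.and ?_ ?_
    · exact Primrec.eq.comp (primrec_int_neg_toNat.comp hi) (Primrec.const 0)
    · exact Primrec.eq.comp (Primrec.list_getElem?.comp
        (Primrec.snd.comp (Primrec.snd.comp Primrec.snd)) (primrec_int_toNat.comp hi))
        (Primrec.option_some.comp (Primrec.snd.comp Primrec.fst))
  exact (PrimrecRel.forall_mem_list key).comp (Primrec.fst.comp Primrec.fst)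
    ((Primrec.snd.comp Primrec.fst).pair Primrec.snd)

variable [TopologicalSpace A] [DiscreteTopology A]

theorem isOpen_setOf_patternAt (p : List (ℤ × A)) (z : ℤ) : IsOpen {x | PatternAt p x z} := by
  have : {x : ℤ → A | PatternAt p x z} = ⋂ q ∈ {q | q ∈ p}, {x | x (z + q.1) = q.2} := by
    ext x; simp [PatternAt]
  rw [this]
  refine Set.Finite.isOpen_biInter (List.finite_toSet p) fun q _ => ?_
  have hc : Continuous fun x : ℤ → A => x (z + q.1) := continuous_apply (z + q.1)
  exact (isOpen_discrete ({q.2} : Set A)).preimage hc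

theorem isClosed_avoiding (F : Set (List (ℤ × A))) : IsClosed (avoiding F) := by
  have : avoiding F = ⋂ p ∈ F, ⋂ z : ℤ, {x | PatternAt p x z}ᶜ := by
    ext x; simp [avoiding]
  rw [this]
  exact isClosed_biInter fun p _ => isClosed_iInter fun z =>
    (isOpen_setOf_patternAt p z).isClosed_compl

/-- The sets of configurations showing a given forbidden pattern at a given place are open. If they
cover the full shift, finitely many suffice, and these inspect only a bounded window. -/
theorem avoiding_eq_empty_iff [Finite A] [Inhabited A] {F : Set (List (ℤ × A))} {l : List A}
    (hl : ∀ a, a ∈ l) :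
    avoiding F = ∅ ↔ ∃ (n : ℕ) (G : List (List (ℤ × A) × ℤ)), (∀ g ∈ G, g.1 ∈ F) ∧
      ∀ u ∈ allWords l (2 * n), ∃ g ∈ G, PatternInWord n u g.1 g.2 := by
  constructor
  · intro h
    obtain ⟨t, ht⟩ := (isCompact_univ (X := ℤ → A)).elim_finite_subcover
      (fun g : F × ℤ => {x | PatternAt g.1.1 x g.2}) (fun g => isOpen_setOf_patternAt _ _) (by
        intro x _
        by_contra hx
        have : x ∈ avoiding F := fun p hp z hz =>
          hx (Set.mem_iUnion.2 ⟨(⟨p, hp⟩, z), hz⟩)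
        rw [h] at this
        exact this)
    let G : List (List (ℤ × A) × ℤ) := t.toList.map fun g => (g.1.1, g.2)
    let B : List ℕ := G.flatMap fun g => g.1.map fun q => (g.2 + q.1).natAbs
    obtain ⟨n, hn⟩ : ∃ n, ∀ b ∈ B, b < n :=
      ⟨B.sum + 1, fun b hb => Nat.lt_succ_of_le (List.le_sum_of_mem hb)⟩
    refine ⟨n, G, ?_, fun u hu => ?_⟩
    · intro g hg
      simp only [G, List.mem_map] at hg
      obtain ⟨g', -, rfl⟩ := hg
      exact g'.1.2
    · have hu' : u.length = 2 * n := (mem_allWords hl).1 hu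
      -- The extension of `u` beyond the window is irrelevant: all patterns of `G` look only inside
      -- it.
      have hx := ht (Set.mem_univ (fun t : ℤ => u.getD (t + n).toNat default))
      simp only [Set.mem_iUnion, exists_prop] at hx
      obtain ⟨g, hg, hgx⟩ := hx
      have hgG : (g.1.1, g.2) ∈ G := List.mem_map.2 ⟨g, by simpa using hg, rfl⟩
      refine ⟨_, hgG, PatternAt.patternInWord hu' (fun q hq => hn _ ?_) hgx⟩
      exact List.mem_flatMap.2 ⟨_, hgG, List.mem_map.2 ⟨q, hq, rfl⟩⟩
  · rintro ⟨n, G, hG, hn⟩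
    rw [Set.eq_empty_iff_forall_notMem]
    intro x hx
    obtain ⟨g, hg, h⟩ := hn (word x (-n) (2 * n)) ((mem_allWords hl).2 (by simp))
    exact hx g.1 (hG g hg) g.2 h.patternAt

/-- It is semidecidable that finitely many additional forbidden patterns leave no configuration. -/
theorem rePred_avoiding_union_eq_empty [Finite A] [Inhabited A] [Primcodable A] {F : Set (List (ℤ × A))}
    (hF : REPred fun p => p ∈ F) :
    REPred fun L : List (List (ℤ × A)) => avoiding (F ∪ {p | p ∈ L}) = ∅ := by
  obtain ⟨f, hf, hfF⟩ := exists_primrec_stage_of_rePred hF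
  obtain ⟨l, hl⟩ : ∃ l : List A, ∀ a, a ∈ l := by
    cases nonempty_fintype A
    exact ⟨Finset.univ.toList, by simp⟩
  -- A certificate is a radius and a list of placed patterns, each with a stage meant to confirm its
  -- membership in `F`; patterns of `L` need no valid stage.
  let R : List (List (ℤ × A)) → ℕ × List ((List (ℤ × A) × ℤ) × ℕ) → Prop := fun L c =>
    (∀ g ∈ c.2, f (g.1.1, g.2) = true ∨ g.1.1 ∈ L) ∧
      ∀ u ∈ allWords l (2 * c.1), ∃ g ∈ c.2, PatternInWord c.1 u g.1.1 g.1.2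
  have hmem : PrimrecRel fun (p : List (ℤ × A)) (L : List (List (ℤ × A))) => p ∈ L := by
    have : PrimrecRel fun (L : List (List (ℤ × A))) (p : List (ℤ × A)) => ∃ a ∈ L, a = p :=
      PrimrecRel.exists_mem_list Primrec.eq
    exact (this.comp Primrec.snd Primrec.fst).of_eq fun q => by simp
  have hR : PrimrecRel R := by
    refine PrimrecPred.and ?_ ?_
    · have h1 : PrimrecRel fun (g : (List (ℤ × A) × ℤ) × ℕ) (L : List (List (ℤ × A))) =>
          f (g.1.1, g.2) = true ∨ g.1.1 ∈ L := by
        refine PrimrecPred.or ?_ ?_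
        · exact Primrec.eq.comp (hf.comp ((Primrec.fst.comp (Primrec.fst.comp Primrec.fst)).pair
            (Primrec.snd.comp Primrec.fst))) (Primrec.const true)
        · exact hmem.comp (Primrec.fst.comp (Primrec.fst.comp Primrec.fst)) Primrec.snd
      exact (PrimrecRel.forall_mem_list h1).comp (Primrec.snd.comp Primrec.snd) Primrec.fst
    · have h1 : PrimrecRel fun (g : (List (ℤ × A) × ℤ) × ℕ) (b : ℕ × List A) =>
          PatternInWord b.1 b.2 g.1.1 g.1.2 :=
        primrec_patternInWord.comp (Primrec.fst.comp Primrec.fst) Primrec.snd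
      have h2 : PrimrecRel fun (u : List A) (c : ℕ × List ((List (ℤ × A) × ℤ) × ℕ)) =>
          ∃ g ∈ c.2, PatternInWord c.1 u g.1.1 g.1.2 :=
        (PrimrecRel.exists_mem_list h1).comp (Primrec.snd.comp Primrec.snd)
          ((Primrec.fst.comp Primrec.snd).pair Primrec.fst)
      exact (PrimrecRel.forall_mem_list h2).comp
        ((primrec_allWords l).comp (Primrec.nat_mul.comp (Primrec.const 2)
          (Primrec.fst.comp Primrec.snd))) Primrec.snd
  refine (rePred_exists_of_primrecRel hR).of_eq fun L => ?_
  rw [avoiding_eq_empty_iff hl]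
  constructor
  · rintro ⟨⟨n, G⟩, h1, h2⟩
    refine ⟨n, G.map Prod.fst, ?_, fun u hu => ?_⟩
    · intro g hg
      obtain ⟨g', hg', rfl⟩ := List.mem_map.1 hg
      exact (h1 g' hg').imp (fun h => (hfF _).2 ⟨_, h⟩) id
    · obtain ⟨g, hg, h⟩ := h2 u hu
      exact ⟨_, List.mem_map_of_mem hg, h⟩
  · rintro ⟨n, G, h1, h2⟩
    have h3 : ∀ g : List (ℤ × A) × ℤ, ∃ s, g ∈ G → f (g.1, s) = true ∨ g.1 ∈ L := by
      intro g
      by_cases hg : g ∈ G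
      · rcases h1 g hg with h | h
        · obtain ⟨s, hs⟩ := (hfF _).1 h
          exact ⟨s, fun _ => Or.inl hs⟩
        · exact ⟨0, fun _ => Or.inr h⟩
      · exact ⟨0, fun h => absurd h hg⟩
    choose s hs using h3
    refine ⟨(n, G.map fun g => (g, s g)), ?_, fun u hu => ?_⟩
    · intro g hg
      obtain ⟨g', hg', rfl⟩ := List.mem_map.1 hg
      exact hs g' hg'
    · obtain ⟨g, hg, h⟩ := h2 u hu
      exact ⟨_, List.mem_map_of_mem hg, h⟩

end Emptiness

/-! ### Subshifts and their languages. -/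

section Topology

variable {A : Type*} [TopologicalSpace A]

/-- A configuration all of whose finite windows occur in a subshift belongs to it. -/
theorem mem_carrier_of_word_mem_language (T : Subshift A ℤ) {x : ℤ → A}
    (h : ∀ n : ℕ, ∃ R ≥ n, word x (-R : ℤ) (2 * R) ∈ language T) : x ∈ T.carrier := by
  choose R hR hw using h
  have h1 : ∀ n, ∃ y ∈ T.carrier, ∀ j < 2 * R n, y (-R n + j) = x (-R n + j) := by
    intro n
    obtain ⟨y, hy, z, hz⟩ := hw n
    -- The translation moves the occurrence at `z` to `-R n`; the points obtained converge to `x`.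
    refine ⟨shift (z + R n) y, T.mapsTo _ hy, fun j hj => ?_⟩
    have := hz j (by simpa using hj)
    simp only [word, List.getElem_map, List.getElem_range] at this
    rw [← this]
    simp only [shift_apply]
    congr 1
    ring
  choose y hy hyx using h1
  refine T.isClosed.mem_of_tendsto (b := Filter.atTop) (f := y) ?_ (Filter.Eventually.of_forall hy)
  rw [tendsto_pi_nhds]
  intro z
  refine tendsto_const_nhds.congr' ?_
  filter_upwards [Filter.eventually_ge_atTop (z.natAbs + 1)] with n hn
  have h2 := hR n
  have h3 := hyx n (z + R n).toNat (by omega)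
  have h4 : -(R n : ℤ) + (z + R n).toNat = z := by omega
  rw [h4] at h3
  exact h3.symm

/-- The subshift of the configurations that avoid a set of patterns. -/
def avoidingSubshift [Finite A] [DiscreteTopology A] (F : Set (List (ℤ × A))) : Subshift A ℤ where
  carrier := avoiding F
  isClosed := isClosed_avoiding F
  mapsTo := fun g x hx p hp z h => hx p hp (g + z) fun q hq => by
    have := h q hq
    rwa [shift_apply, ← add_assoc] at this

theorem word_mem_language_iff {S : Subshift A ℤ} {w : List A} :
    w ∈ language S ↔ ∃ x ∈ S.carrier, ∃ z, PatternAt (wordPattern w) x z := by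
  simp only [patternAt_wordPattern]
  rfl

theorem exists_word_eq_of_mem_language {S : Subshift A ℤ} {w : List A} (hw : w ∈ language S)
    (a : ℤ) : ∃ y ∈ S.carrier, word y a w.length = w := by
  obtain ⟨x, hx, z, h⟩ := hw
  refine ⟨shift (z - a) x, S.mapsTo _ hx, List.ext_getElem (by simp) fun i h1 h2 => ?_⟩
  simp only [word, List.getElem_map, List.getElem_range, shift_apply]
  rw [← h i h2]
  congr 1
  ring

theorem word_mem_language {S : Subshift A ℤ} {x : ℤ → A} (hx : x ∈ S.carrier) (a : ℤ) (n : ℕ) :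
    word x a n ∈ language S :=
  ⟨x, hx, a, fun i hi => by simp [word]⟩

end Topology

/-! ### Greedy construction of a minimal subshift. -/

section Greedy

variable {A : Type*} [Primcodable A]

/-- Patterns are added one after the other, unless `e` reports that this would leave nothing. -/
def greedy (e : List (List (ℤ × A)) → Bool) (n : ℕ) : List (List (ℤ × A)) :=
  Nat.rec [] (fun n L => bif e ((decode n).getD [] :: L) then L else (decode n).getD [] :: L) n

theorem greedy_succ (e : List (List (ℤ × A)) → Bool) (n : ℕ) :
    greedy e (n + 1) = bif e ((decode n).getD [] :: greedy e n) then greedy e n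
      else (decode n).getD [] :: greedy e n := rfl

theorem computableIn_greedy {O : Set (ℕ →. ℕ)} {e : List (List (ℤ × A)) → Bool}
    (he : ComputableIn O e) : ComputableIn O (greedy e) := by
  have hc : ComputableIn O fun q : ℕ × ℕ × List (List (ℤ × A)) =>
      (decode (α := List (ℤ × A)) q.2.1).getD [] :: q.2.2 :=
    (Primrec.list_cons.comp (Primrec.option_getD.comp (Primrec.decode.comp
      (Primrec.fst.comp Primrec.snd)) (Primrec.const [])) (Primrec.snd.comp Primrec.snd)).computableIn
  have hs : ComputableIn O fun q : ℕ × ℕ × List (List (ℤ × A)) => q.2.2 :=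
    (Primrec.snd.comp Primrec.snd).computableIn
  exact ComputableIn.nat_rec (f := fun n : ℕ => n) (g := fun _ => [])
    (h := fun _ q => bif e ((decode q.1).getD [] :: q.2) then q.2 else (decode q.1).getD [] :: q.2)
    ComputableIn.id (ComputableIn.const _) (ComputableIn.cond (he.comp hc) hs hc)

theorem greedy_mono (e : List (List (ℤ × A)) → Bool) {m n : ℕ} (h : m ≤ n)
    {p : List (ℤ × A)} (hp : p ∈ greedy e m) : p ∈ greedy e n := by
  induction n, h using Nat.le_induction with
  | base => exact hp
  | succ n _ ih =>
    rw [greedy_succ]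
    cases e ((decode n).getD [] :: greedy e n) <;> simp [ih]

variable [Finite A] [TopologicalSpace A] [DiscreteTopology A]

/-- In the greedy limit every pattern is either forbidden or unavoidable. This dichotomy gives
minimality, and it lets one oracle answer decide each word. -/
theorem exists_minimal_language_le (S : Subshift A ℤ) (hS : S.carrier.Nonempty)
    (heff : IsEffective S) :
    ∃ T : Subshift A ℤ, T.carrier ⊆ S.carrier ∧ IsMinimal T ∧
      setDegree (language T) ≤ zeroJump := by
  classical
  obtain ⟨F, hF, hSF⟩ := heff
  obtain ⟨x₀, hx₀⟩ := hS
  have : Inhabited A := ⟨x₀ 0⟩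
  have hE := (degree_le_degree _ _).1
    (setDegree_le_zeroJump_of_rePred (s := {L : List (List (ℤ × A)) | avoiding (F ∪ {p | p ∈ L}) = ∅})
      (rePred_avoiding_union_eq_empty hF))
  set e : List (List (ℤ × A)) → Bool :=
    fun L => decide (L ∈ {L : List (List (ℤ × A)) | avoiding (F ∪ {p | p ∈ L}) = ∅}) with he
  have heq : ∀ L, e L = true ↔ avoiding (F ∪ {p | p ∈ L}) = ∅ := fun L => by simp [he]
  have hne : ∀ n, (avoiding (F ∪ {p | p ∈ greedy e n})).Nonempty := by
    intro n
    induction n with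
    | zero => exact ⟨x₀, by simpa [greedy, ← hSF] using hx₀⟩
    | succ n ih =>
      rw [greedy_succ]
      cases h : e ((decode n).getD [] :: greedy e n) with
      | true => exact ih
      | false =>
        rw [Set.nonempty_iff_ne_empty, Ne, cond_false, ← heq, h]
        simp
  let F' : Set (List (ℤ × A)) := F ∪ ⋃ n, {p | p ∈ greedy e n}
  have hF' : avoiding F' = ⋂ n, avoiding (F ∪ {p | p ∈ greedy e n}) := by
    ext x
    simp only [F', avoiding, Set.mem_iInter, Set.mem_ofPred_eq, Set.mem_union, Set.mem_iUnion]
    constructor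
    · rintro h n p (hp | hp)
      · exact h p (Or.inl hp)
      · exact h p (Or.inr ⟨n, hp⟩)
    · rintro h p (hp | ⟨n, hp⟩)
      · exact h 0 p (Or.inl hp)
      · exact h n p (Or.inr hp)
  have hT : (avoiding F').Nonempty := by
    rw [hF']
    refine IsCompact.nonempty_iInter_of_sequence_nonempty_isCompact_isClosed _ (fun n => ?_) hne
      (isClosed_avoiding _).isCompact fun n => isClosed_avoiding _
    intro x hx p hp
    exact hx p (hp.imp id fun h => greedy_mono e n.le_succ h)
  -- The pattern `p` is treated at the stage given by its own code.
  have hadd : ∀ p : List (ℤ × A), e (p :: greedy e (encode p)) = false → p ∈ F' := by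
    intro p hp
    refine Or.inr (Set.mem_iUnion.2 ⟨encode p + 1, ?_⟩)
    rw [Set.mem_ofPred_eq, greedy_succ, encodek, Option.getD_some, hp]
    simp
  -- A limit point avoiding `p` would survive the addition that was found to leave nothing.
  have hnot : ∀ p : List (ℤ × A), e (p :: greedy e (encode p)) = true →
      ∀ x ∈ avoiding F', ∃ z, PatternAt p x z := by
    intro p hp x hx
    by_contra h
    have h1 : x ∈ avoiding (F ∪ {q | q ∈ p :: greedy e (encode p)}) := by
      rintro q (hq | hq)
      · exact hx q (Or.inl hq)
      · rcases List.mem_cons.1 hq with rfl | hq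
        · exact fun z hz => h ⟨z, hz⟩
        · exact hx q (Or.inr (Set.mem_iUnion.2 ⟨_, hq⟩))
    rw [(heq _).1 hp] at h1
    exact h1
  have hlang : ∀ p : List (ℤ × A), (∃ x ∈ avoiding F', ∃ z, PatternAt p x z) ↔
      e (p :: greedy e (encode p)) = true := by
    intro p
    constructor
    · rintro ⟨x, hx, z, hz⟩
      by_contra h
      exact hx p (hadd p (by simpa using h)) z hz
    · intro h
      obtain ⟨x, hx⟩ := hT
      exact ⟨x, hx, hnot p h x hx⟩
  refine ⟨avoidingSubshift F', ?_, ⟨hT, fun T hTne hTsub => ?_⟩, ?_⟩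
  · rw [hSF]
    exact fun x hx p hp => hx p (Or.inl hp)
  · refine Set.Subset.antisymm hTsub fun x hx => ?_
    obtain ⟨t, ht⟩ := hTne
    -- Each window of `x` is an unforbidden pattern, so it occurs in the point `t` of `T` as well.
    refine mem_carrier_of_word_mem_language T fun n => ⟨n, le_rfl, word_mem_language_iff.2 ⟨t, ht, ?_⟩⟩
    refine hnot _ ((hlang _).1 ?_) t (hTsub ht)
    exact word_mem_language_iff (S := avoidingSubshift F').1 (word_mem_language hx _ _)
  · refine (degree_le_degree _ _).2 ?_
    have h1 : ComputableIn {codeFun fun a : Nat.Partrec.Code × ℕ =>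
        decide (a ∈ {p : Nat.Partrec.Code × ℕ | (p.1.eval p.2).Dom})}
        fun w : List A => e (wordPattern w :: greedy e (encode (wordPattern w))) := by
      have hp := primrec_wordPattern (A := A)
      refine hE.comp (ComputableIn.comp Primrec.list_cons.computableIn₂
        (ComputableIn.pair hp.computableIn ?_))
      exact (computableIn_greedy hE).comp (Primrec.encode.comp hp).computableIn
    refine h1.of_eq fun w => ?_
    rw [Bool.eq_iff_iff, ← hlang, decide_eq_true_iff, word_mem_language_iff]
    rfl

end Greedy

/-! ### Mismatches between a configuration and its translates. -/

/-- With `m` coding a pair `(r, k)`: the configuration and its translate by `r`, read from `-R` on,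
differ for the first time at distance `k`, and this is to the right of `[-R, R)`. -/
def IsMismatch {A : Type*} (x : ℤ → A) (R m : ℕ) : Prop :=
  2 * R ≤ m.unpair.2 ∧ (∀ j < m.unpair.2, x (-R + j) = x (-R + m.unpair.1 + j)) ∧
    x (-R + m.unpair.2) ≠ x (-R + m.unpair.1 + m.unpair.2)

/-- The first mismatch in the order of the codes. -/
def IsFirstMismatch {A : Type*} (x : ℤ → A) (R m : ℕ) : Prop :=
  IsMismatch x R m ∧ ∀ m' < m, ¬ IsMismatch x R m'

theorem IsFirstMismatch.unique {A : Type*} {x : ℤ → A} {R m m' : ℕ}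
    (h : IsFirstMismatch x R m) (h' : IsFirstMismatch x R m') : m = m' := by
  rcases lt_trichotomy m m' with hlt | rfl | hlt
  · exact absurd h.1 (h'.2 _ hlt)
  · rfl
  · exact absurd h'.1 (h.2 _ hlt)

/-! ### Periodicity to the right yields a computable point. -/

section Periodic

variable {A : Type*}

/-- A configuration with a positive period is computable. -/
theorem computable_of_periodic [Primcodable A] {y : ℤ → A} {r : ℕ} (hr : 0 < r)
    (hy : ∀ z, y (z % r) = y z) : Computable y := by
  have hf : ∀ f : ℕ → A, Primrec fun n : ℕ => ((List.range r).map f)[n % r]?.getD (y 0) :=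
    fun f => Primrec.option_getD.comp (Primrec.list_getElem?.comp (Primrec.const _)
      (Primrec.nat_mod.comp Primrec.id (Primrec.const r))) (Primrec.const _)
  have hfv : ∀ (f : ℕ → A) (n : ℕ), ((List.range r).map f)[n % r]?.getD (y 0) = f (n % r) := by
    intro f n
    have : n % r < r := Nat.mod_lt _ hr
    simp [this]
  have hneg : ∀ n : ℕ, y (-((n % r : ℕ) : ℤ)) = y (-n) := by
    intro n
    rw [← hy (-((n % r : ℕ) : ℤ)), ← hy (-n)]
    congr 1
    push_cast
    exact (Int.ModEq.neg (Int.mod_modEq n r))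
  refine Primrec.to_comp ((Primrec.ite (c := fun z : ℤ => (-z).toNat = 0)
    (Primrec.eq.comp primrec_int_neg_toNat (Primrec.const 0))
    ((hf fun n => y n).comp primrec_int_toNat)
    ((hf fun n => y (-n)).comp primrec_int_neg_toNat)).of_eq fun z => ?_)
  rw [hfv, hfv]
  split_ifs with h
  · rw [Int.natCast_mod, hy]
    congr 1
    omega
  · rw [hneg]
    congr 1
    omega

variable [TopologicalSpace A]

/-- A subshift with a point that is periodic to the right has a computable point. -/
theorem exists_computable_of_periodic_right [Primcodable A] (T : Subshift A ℤ) {x : ℤ → A}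
    (hx : x ∈ T.carrier) {a : ℤ} {r : ℕ} (hr : 0 < r) (h : ∀ j : ℕ, x (a + j) = x (a + r + j)) :
    ∃ y ∈ T.carrier, Computable y := by
  have hmul : ∀ (n j : ℕ), x (a + j) = x (a + (j + n * r : ℕ)) := by
    intro n j
    induction n with
    | zero => simp
    | succ n ih =>
      rw [ih, h]
      congr 1
      push_cast
      ring
  have hr' : (0 : ℤ) < r := by exact_mod_cast hr
  let y : ℤ → A := fun z => x (a + z % r)
  have hmod : ∀ z : ℤ, y (z % r) = y z := fun z => by simp [y]
  refine ⟨y, mem_carrier_of_word_mem_language T fun n => ⟨n, le_rfl, ?_⟩,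
    computable_of_periodic hr hmod⟩
  -- Moving right by the multiple `n * r` of the period brings `[-n, n)` into the range where `x` is
  -- periodic.
  refine ⟨x, hx, a + (-n + n * r : ℤ), fun i hi => ?_⟩
  simp only [word, List.getElem_map, List.getElem_range, y]
  obtain ⟨t, ht⟩ : ∃ t : ℕ, (t : ℤ) = -n + n * r + i :=
    ⟨(-n + n * r + i : ℤ).toNat, Int.toNat_of_nonneg (by nlinarith)⟩
  have h1 : a + (-n + n * r : ℤ) + i = a + t := by rw [ht]; ring
  have h2 : (-n + i : ℤ) % r = ((t % r : ℕ) : ℤ) := by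
    rw [Int.natCast_mod, ht]
    have : (-n + n * r + i : ℤ) = -n + i + r * n := by ring
    rw [this, Int.add_mul_emod_self_left]
  have h3 := hmul (t / r) (t % r)
  rw [Nat.mod_add_div'] at h3
  rw [h1, h2, h3]

end Periodic

/-! ### Lexicographic extremes, recurrence and the order at a mismatch. -/

section Extremal

variable {A : Type*} [Finite A] [TopologicalSpace A] [DiscreteTopology A]

/-- A non-empty compact set of configurations has a lexicographically greatest element. -/
theorem exists_lex_max (e : A → ℤ) (a : ℤ) {K : Set (ℤ → A)} (hK : IsClosed K) (hne : K.Nonempty) :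
    ∃ x ∈ K, ∀ y ∈ K, ∀ k : ℕ, (∀ j < k, y (a + j) = x (a + j)) → e (y (a + k)) ≤ e (x (a + k)) := by
  -- Stage `n` keeps the points that maximise `e` at coordinate `a + n` among those still present.
  let next : ℕ → Set (ℤ → A) → Set (ℤ → A) := fun n C =>
    {x | x ∈ C ∧ ∀ y ∈ C, e (y (a + n)) ≤ e (x (a + n))}
  let C : ℕ → Set (ℤ → A) := fun n => Nat.rec K next n
  have hC : ∀ n, C (n + 1) = next n (C n) := fun n => rfl
  have hprop : ∀ n, IsClosed (C n) ∧ (C n).Nonempty := by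
    intro n
    induction n with
    | zero => exact ⟨hK, hne⟩
    | succ n ih =>
      rw [hC]
      constructor
      · have : next n (C n) = C n ∩ (fun x : ℤ → A => x (a + n)) ⁻¹'
            {b | ∀ y ∈ C n, e (y (a + n)) ≤ e b} := rfl
        rw [this]
        exact ih.1.inter ((isClosed_discrete _).preimage (continuous_apply _))
      · have hfin : ((fun x : ℤ → A => x (a + n)) '' C n).Finite :=
          (Set.finite_univ (α := A)).subset (Set.subset_univ _)
        obtain ⟨c, hc, hmax⟩ := Set.exists_max_image _ e hfin (ih.2.image _)
        obtain ⟨x, hx, rfl⟩ := hc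
        exact ⟨x, hx, fun y hy => hmax _ ⟨y, hy, rfl⟩⟩
  obtain ⟨x, hx⟩ := IsCompact.nonempty_iInter_of_sequence_nonempty_isCompact_isClosed C
    (fun n x hx => hx.1) (fun n => (hprop n).2) (hprop 0).1.isCompact fun n => (hprop n).1
  rw [Set.mem_iInter] at hx
  refine ⟨x, hx 0, fun y hy k hk => ?_⟩
  have hyk : ∀ n ≤ k, y ∈ C n := by
    intro n hn
    induction n with
    | zero => exact hy
    | succ n ih =>
      refine ⟨ih (by omega), fun z hz => ?_⟩
      rw [hk n (by omega)]
      exact (hx (n + 1)).2 z hz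
  exact (hx (k + 1)).2 y (hyk k le_rfl)

/-- Words of a point of a minimal subshift occur again further to the right. -/
theorem IsMinimal.exists_recurrence {T : Subshift A ℤ} (hT : IsMinimal T) {x : ℤ → A}
    (hx : x ∈ T.carrier) (a : ℤ) (n : ℕ) :
    ∃ r : ℕ, 0 < r ∧ ∀ j < n, x (a + j) = x (a + r + j) := by
  set p := wordPattern (word x a n) with hp
  have hpat : ∀ (y : ℤ → A) z, PatternAt p y z ↔ ∀ j < n, y (z + j) = x (a + j) := by
    intro y z
    rw [hp, patternAt_wordPattern]
    simp [word]
  suffices ∃ z > a, PatternAt p x z by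
    obtain ⟨z, hz, h⟩ := this
    refine ⟨(z - a).toNat, by omega, fun j hj => ?_⟩
    rw [← (hpat x z).1 h j hj]
    congr 1
    omega
  by_contra! hno
  -- If the word never recurs to the right, translates of `x` avoid it on ever longer half-lines. A
  -- point common to all `D i` avoids it everywhere, so forbidding it leaves a proper non-empty
  -- subshift.
  let D : ℕ → Set (ℤ → A) := fun i => T.carrier ∩ ⋂ z : ℤ, ⋂ _ : -(i : ℤ) < z, {y | PatternAt p y z}ᶜ
  have hD : ∀ i y, y ∈ D i ↔ y ∈ T.carrier ∧ ∀ z : ℤ, -(i : ℤ) < z → ¬ PatternAt p y z := by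
    intro i y; simp [D]
  have hDc : ∀ i, IsClosed (D i) := fun i => T.isClosed.inter
    (isClosed_iInter fun z => isClosed_iInter fun _ => (isOpen_setOf_patternAt p z).isClosed_compl)
  obtain ⟨y, hy⟩ := IsCompact.nonempty_iInter_of_sequence_nonempty_isCompact_isClosed D
    (fun i y hy => by
      rw [hD] at hy ⊢
      exact ⟨hy.1, fun z hz => hy.2 z (by push_cast; omega)⟩)
    (fun i => by
      refine ⟨shift (a + i) x, (hD _ _).2 ⟨T.mapsTo _ hx, fun z hz h => hno (a + i + z) (by omega) ?_⟩⟩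
      intro q hq
      have := h q hq
      rwa [shift_apply, ← add_assoc] at this)
    (hDc 0).isCompact hDc
  rw [Set.mem_iInter] at hy
  let T' : Subshift A ℤ :=
    { carrier := T.carrier ∩ (avoidingSubshift {p}).carrier
      isClosed := T.isClosed.inter (avoidingSubshift {p}).isClosed
      mapsTo := fun g => Set.MapsTo.inter_inter (T.mapsTo g) ((avoidingSubshift {p}).mapsTo g) }
  have hyT : y ∈ T'.carrier := by
    refine ⟨((hD 0 y).1 (hy 0)).1, ?_⟩
    rintro q rfl z
    exact ((hD (z.natAbs + 1) y).1 (hy _)).2 z (by omega)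
  have hxT : x ∈ T'.carrier := by
    rw [hT.2 T' ⟨y, hyT⟩ Set.inter_subset_left]
    exact hx
  exact hxT.2 p rfl a ((hpat x a).2 fun j _ => rfl)

/-- A recurrence of the window that never breaks would make `x` periodic to the right, which is
impossible without computable points. -/
theorem IsMinimal.exists_isFirstMismatch [Primcodable A] {T : Subshift A ℤ} (hT : IsMinimal T)
    (hc : ∀ x ∈ T.carrier, ¬ Computable x) {x : ℤ → A} (hx : x ∈ T.carrier) (R : ℕ) :
    ∃ m, IsFirstMismatch x R m := by
  classical
  obtain ⟨r, hr, h⟩ := hT.exists_recurrence hx (-R) (2 * R)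
  have h1 : ∃ k : ℕ, x (-R + k) ≠ x (-R + r + k) := by
    by_contra! h2
    obtain ⟨y, hy, hyc⟩ := exists_computable_of_periodic_right T hx hr h2
    exact hc y hy hyc
  have h2 : ∃ m, IsMismatch x R m := by
    refine ⟨Nat.pair r (Nat.find h1), ?_⟩
    simp only [IsMismatch, Nat.unpair_pair]
    refine ⟨?_, fun j hj => not_not.1 (Nat.find_min h1 hj), Nat.find_spec h1⟩
    by_contra hlt
    exact Nat.find_spec h1 (h _ (by omega))
  exact ⟨Nat.find h2, Nat.find_spec h2, fun m' hm' => Nat.find_min h2 hm'⟩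

/-- Each word of an aperiodic minimal subshift extends so that the letters at the first mismatch
are in the prescribed order. -/
theorem IsMinimal.exists_mismatch_order [Primcodable A] {T : Subshift A ℤ} (hT : IsMinimal T)
    (hc : ∀ x ∈ T.carrier, ¬ Computable x) {w : List A} (hw : w ∈ language T) {R : ℕ}
    (hR : w.length = 2 * R) (b : Bool) :
    ∃ x ∈ T.carrier, word x (-R) (2 * R) = w ∧ ∃ m, IsFirstMismatch x R m ∧
      decide (encode (x (-R + m.unpair.2)) < encode (x (-R + m.unpair.1 + m.unpair.2))) = b := by
  let K : Set (ℤ → A) := T.carrier ∩ {x | PatternAt (wordPattern w) x (-R)}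
  have hK : ∀ x, x ∈ K ↔ x ∈ T.carrier ∧ word x (-R) (2 * R) = w := by
    intro x
    refine and_congr_right fun _ => ?_
    rw [Set.mem_ofPred_eq, patternAt_wordPattern]
    constructor
    · exact fun h => List.ext_getElem (by simp [hR]) fun i h1 h2 => by simpa [word] using h i h2
    · intro h i hi
      have h' := getElem?_word x (-R) (hR ▸ hi : i < 2 * R)
      rw [h, List.getElem?_eq_getElem hi] at h'
      exact (Option.some_inj.1 h').symm
  have hKc : IsClosed K := by
    refine T.isClosed.inter ?_
    have : {x : ℤ → A | PatternAt (wordPattern w) x (-R)} =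
        ⋂ q ∈ {q | q ∈ wordPattern w}, (fun x : ℤ → A => x (-R + q.1)) ⁻¹' {q.2} := by
      ext x; simp [PatternAt]
    rw [this]
    exact isClosed_biInter fun q _ => (isClosed_discrete _).preimage (continuous_apply _)
  have hKne : K.Nonempty := by
    obtain ⟨y, hy, hyw⟩ := exists_word_eq_of_mem_language hw (-R)
    exact ⟨y, (hK y).2 ⟨hy, by rw [← hR]; exact hyw⟩⟩
  obtain ⟨x, hx, hmax⟩ := exists_lex_max
    -- For `b = true` the sign change selects the lexicographically least point.
    (fun c : A => bif b then -(encode c : ℤ) else (encode c : ℤ)) (-R) hKc hKne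
  obtain ⟨hxT, hxw⟩ := (hK x).1 hx
  obtain ⟨m, hm⟩ := hT.exists_isFirstMismatch hc hxT R
  refine ⟨x, hxT, hxw, m, hm, ?_⟩
  obtain ⟨⟨h1, h2, h3⟩, -⟩ := hm
  have hs : ∀ j : ℕ, shift (m.unpair.1 : ℤ) x (-R + j) = x (-R + m.unpair.1 + j) := by
    intro j
    rw [shift_apply]
    congr 1
    ring
  -- The mismatch lies to the right of `[-R, R)`, so the translate shows the same word there and
  -- competes with `x` in `K`.
  have hsK : shift (m.unpair.1 : ℤ) x ∈ K := by
    refine (hK _).2 ⟨T.mapsTo _ hxT, ?_⟩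
    rw [← hxw, word_eq_iff]
    intro j hj
    rw [hs, ← h2 j (by omega)]
  have h4 := hmax _ hsK m.unpair.2 fun j hj => by rw [hs, ← h2 j hj]
  have h5 : encode (x (-R + m.unpair.2)) ≠ encode (x (-R + m.unpair.1 + m.unpair.2)) :=
    fun h => h3 (encode_injective h)
  rw [hs] at h4
  cases b
  · simp only [cond_false, Nat.cast_le] at h4
    simpa using h4
  · simp only [cond_true, neg_le_neg_iff, Nat.cast_le] at h4
    simpa using lt_of_le_of_ne h4 h5

end Extremal

/-! ### Reading and coding bits in finite words. -/

section Coding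

variable {A : Type*}

/-- `IsMismatch` for a word whose position `d` corresponds to `-R`. -/
def IsWordMismatch (u : List A) (d R m : ℕ) : Prop :=
  2 * R ≤ m.unpair.2 ∧ (∀ j < m.unpair.2, u[d + j]? = u[d + m.unpair.1 + j]?) ∧
    u[d + m.unpair.2]? ≠ u[d + m.unpair.1 + m.unpair.2]?

/-- `IsFirstMismatch` for a word placed on `[-(R + 2 * m + 1), R + 2 * m + 1)`. -/
def IsFirstWordMismatch (u : List A) (R m : ℕ) : Prop :=
  IsWordMismatch u (2 * m + 1) R m ∧ ∀ m' < m, ¬ IsWordMismatch u (2 * m + 1) R m'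

/-- The bit coded by the letters at the mismatch. -/
def mismatchBit [Primcodable A] (u : List A) (m : ℕ) : Bool :=
  decide (encode u[2 * m + 1 + m.unpair.2]? <
    encode u[2 * m + 1 + m.unpair.1 + m.unpair.2]?)

/-- The window `[-n, n)` of a configuration. -/
def window (x : ℤ → A) (n : ℕ) : List A :=
  word x (-n) (2 * n)

theorem getElem?_window (x : ℤ → A) {R m i : ℕ} (h : i ≤ 2 * m) :
    (window x (R + 2 * m + 1))[2 * m + 1 + i]? = some (x (-R + i)) := by
  rw [window, getElem?_word _ _ (by omega)]
  congr 2
  push_cast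
  ring

/-- Both components of the pair coded by `m'` are at most `m`, so only positions in `[-R, -R + 2 *
m]` matter. A finite window thus certifies that `m` is the first mismatch. -/
theorem isWordMismatch_window {x : ℤ → A} {R m m' : ℕ} (h : m' ≤ m) :
    IsWordMismatch (window x (R + 2 * m + 1)) (2 * m + 1) R m' ↔ IsMismatch x R m' := by
  have h1 := Nat.unpair_left_le m'
  have h2 := Nat.unpair_right_le m'
  have h3 : ∀ j ≤ m'.unpair.2, (window x (R + 2 * m + 1))[2 * m + 1 + j]? = some (x (-R + j)) :=
    fun j hj => getElem?_window x (by omega)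
  have h4 : ∀ j ≤ m'.unpair.2, (window x (R + 2 * m + 1))[2 * m + 1 + m'.unpair.1 + j]? =
      some (x (-R + m'.unpair.1 + j)) := fun j hj => by
    rw [add_assoc (2 * m + 1), getElem?_window x (by omega)]
    push_cast
    rw [add_assoc]
  unfold IsWordMismatch IsMismatch
  rw [h3 _ le_rfl, h4 _ le_rfl]
  refine and_congr_right fun _ => and_congr (forall₂_congr fun j hj => ?_) (by simp)
  rw [h3 _ hj.le, h4 _ hj.le, Option.some_inj]

theorem isFirstWordMismatch_window {x : ℤ → A} {R m : ℕ} :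
    IsFirstWordMismatch (window x (R + 2 * m + 1)) R m ↔ IsFirstMismatch x R m :=
  and_congr (isWordMismatch_window le_rfl)
    (forall₂_congr fun _ h => not_congr (isWordMismatch_window h.le))

theorem mismatchBit_window [Primcodable A] {x : ℤ → A} {R m : ℕ} :
    mismatchBit (window x (R + 2 * m + 1)) m =
      decide (encode (x (-R + m.unpair.2)) < encode (x (-R + m.unpair.1 + m.unpair.2))) := by
  have h1 := Nat.unpair_left_le m
  have h2 := Nat.unpair_right_le m
  rw [mismatchBit, getElem?_window x (by omega), add_assoc (2 * m + 1), getElem?_window x (by omega)]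
  push_cast
  simp [add_assoc]

variable [Primcodable A]

theorem primrec_isWordMismatch :
    PrimrecRel fun (m : ℕ) (v : List A × ℕ × ℕ) => IsWordMismatch v.1 v.2.1 v.2.2 m := by
  have hr : Primrec fun q : ℕ × (List A × ℕ × ℕ) => q.1.unpair.1 :=
    Primrec.fst.comp (Primrec.unpair.comp Primrec.fst)
  have hk : Primrec fun q : ℕ × (List A × ℕ × ℕ) => q.1.unpair.2 :=
    Primrec.snd.comp (Primrec.unpair.comp Primrec.fst)
  have hu : Primrec fun q : ℕ × (List A × ℕ × ℕ) => q.2.1 := Primrec.fst.comp Primrec.snd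
  have hd : Primrec fun q : ℕ × (List A × ℕ × ℕ) => q.2.2.1 :=
    Primrec.fst.comp (Primrec.snd.comp Primrec.snd)
  have hR : Primrec fun q : ℕ × (List A × ℕ × ℕ) => q.2.2.2 :=
    Primrec.snd.comp (Primrec.snd.comp Primrec.snd)
  have heq : PrimrecRel fun (j : ℕ) (q : ℕ × (List A × ℕ × ℕ)) =>
      q.2.1[q.2.2.1 + j]? = q.2.1[q.2.2.1 + q.1.unpair.1 + j]? :=
    Primrec.eq.comp
      (Primrec.list_getElem?.comp (hu.comp Primrec.snd)
        (Primrec.nat_add.comp (hd.comp Primrec.snd) Primrec.fst))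
      (Primrec.list_getElem?.comp (hu.comp Primrec.snd)
        (Primrec.nat_add.comp (Primrec.nat_add.comp (hd.comp Primrec.snd) (hr.comp Primrec.snd))
          Primrec.fst))
  refine PrimrecPred.and ?_ (PrimrecPred.and ?_ (PrimrecPred.not ?_))
  · exact Primrec.nat_le.comp (Primrec.nat_mul.comp (Primrec.const 2) hR) hk
  · exact ((PrimrecRel.forall_mem_list heq).comp (Primrec.list_range.comp hk) Primrec.id).of_eq
      fun q => by simp
  · exact heq.comp hk Primrec.id

theorem primrec_isFirstWordMismatch :
    PrimrecPred fun v : List A × ℕ × ℕ => IsFirstWordMismatch v.1 v.2.1 v.2.2 := by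
  have hd : Primrec fun v : List A × ℕ × ℕ => 2 * v.2.2 + 1 :=
    Primrec.succ.comp (Primrec.nat_mul.comp (Primrec.const 2) (Primrec.snd.comp Primrec.snd))
  have hv : Primrec fun v : List A × ℕ × ℕ => (v.1, 2 * v.2.2 + 1, v.2.1) :=
    Primrec.fst.pair (hd.pair (Primrec.fst.comp Primrec.snd))
  have hm : Primrec fun v : List A × ℕ × ℕ => v.2.2 := Primrec.snd.comp Primrec.snd
  refine PrimrecPred.and (primrec_isWordMismatch.comp hm hv) ?_
  have h : PrimrecRel fun (m : ℕ) (v : List A × ℕ × ℕ) =>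
      ¬ IsWordMismatch v.1 (2 * v.2.2 + 1) v.2.1 m :=
    PrimrecPred.not (primrec_isWordMismatch.comp Primrec.fst (hv.comp Primrec.snd))
  exact ((PrimrecRel.forall_mem_list h).comp (Primrec.list_range.comp hm) Primrec.id).of_eq
    fun q => by simp

theorem primrec_mismatchBit : Primrec₂ (mismatchBit (A := A)) := by
  have hr : Primrec fun q : List A × ℕ => q.2.unpair.1 :=
    Primrec.fst.comp (Primrec.unpair.comp Primrec.snd)
  have hk : Primrec fun q : List A × ℕ => q.2.unpair.2 :=
    Primrec.snd.comp (Primrec.unpair.comp Primrec.snd)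
  have hd : Primrec fun q : List A × ℕ => 2 * q.2 + 1 :=
    Primrec.succ.comp (Primrec.nat_mul.comp (Primrec.const 2) Primrec.snd)
  exact PrimrecRel.decide (Primrec.nat_lt) |>.comp
    (Primrec.encode.comp (Primrec.list_getElem?.comp Primrec.fst (Primrec.nat_add.comp hd hk)))
    (Primrec.encode.comp (Primrec.list_getElem?.comp Primrec.fst
      (Primrec.nat_add.comp (Primrec.nat_add.comp hd hr) hk)))

/-- The word `w`, placed on `[-R, R)`, is extended to a longer word `u` that codes the bit `b` at
its first mismatch `m`. -/
def IsCodingStep (w : List A) (b : Bool) (u : List A) (m : ℕ) : Prop :=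
  u.length = 2 * (w.length / 2 + 2 * m + 1) ∧
    (u.drop (2 * m + 1)).take (2 * (w.length / 2)) = w ∧
      IsFirstWordMismatch u (w.length / 2) m ∧ mismatchBit u m = b

theorem primrec_isCodingStep :
    PrimrecPred fun v : (List A × Bool) × (List A × ℕ) =>
      IsCodingStep v.1.1 v.1.2 v.2.1 v.2.2 := by
  have hw : Primrec fun v : (List A × Bool) × (List A × ℕ) => v.1.1 := Primrec.fst.comp Primrec.fst
  have hb : Primrec fun v : (List A × Bool) × (List A × ℕ) => v.1.2 := Primrec.snd.comp Primrec.fst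
  have hu : Primrec fun v : (List A × Bool) × (List A × ℕ) => v.2.1 := Primrec.fst.comp Primrec.snd
  have hm : Primrec fun v : (List A × Bool) × (List A × ℕ) => v.2.2 := Primrec.snd.comp Primrec.snd
  have hR : Primrec fun v : (List A × Bool) × (List A × ℕ) => v.1.1.length / 2 :=
    Primrec.nat_div.comp (Primrec.list_length.comp hw) (Primrec.const 2)
  have h2m : Primrec fun v : (List A × Bool) × (List A × ℕ) => 2 * v.2.2 :=
    Primrec.nat_mul.comp (Primrec.const 2) hm
  refine PrimrecPred.and ?_ (PrimrecPred.and ?_ (PrimrecPred.and ?_ ?_))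
  · exact Primrec.eq.comp (Primrec.list_length.comp hu) (Primrec.nat_mul.comp (Primrec.const 2)
      (Primrec.succ.comp (Primrec.nat_add.comp hR h2m)))
  · exact Primrec.eq.comp (Primrec.list_take.comp (Primrec.nat_mul.comp (Primrec.const 2) hR)
      (Primrec.list_drop.comp (Primrec.succ.comp h2m) hu)) hw
  · exact primrec_isFirstWordMismatch.comp (hu.pair (hR.pair hm))
  · exact Primrec.eq.comp (primrec_mismatchBit.comp hu hm) hb

theorem computableIn_window {O : Set (ℕ →. ℕ)} {x : ℤ → A} (hx : ComputableIn O x) :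
    ComputableIn O (window x) := by
  have h1 : ComputableIn O fun q : ℕ × ℕ × List A => x (-(q.1 : ℤ) + q.2.1) :=
    hx.comp (Primrec.computableIn ((primrec_natCast_sub_natCast.comp
      (Primrec.fst.comp Primrec.snd) Primrec.fst).of_eq fun q => by ring))
  have h2 : ComputableIn₂ O fun (n : ℕ) (q : ℕ × List A) => q.2 ++ [x (-(n : ℤ) + q.1)] :=
    ComputableIn.comp Primrec.list_concat.computableIn₂
      (ComputableIn.pair (Primrec.computableIn (Primrec.snd.comp Primrec.snd)) h1)
  refine (ComputableIn.nat_rec (f := fun n : ℕ => 2 * n)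
    (Primrec.computableIn (Primrec.nat_mul.comp (Primrec.const 2) Primrec.id))
    (ComputableIn.const []) h2).of_eq fun n => ?_
  rw [window]
  induction 2 * n with
  | zero => rfl
  | succ k ih => simp only [ih]; simp [word, List.range_succ]

end Coding

/-! ### Points of prescribed degree. -/

section Degree

variable {A : Type*} [Finite A] [Primcodable A] [TopologicalSpace A] [DiscreteTopology A]

theorem IsMinimal.exists_isCodingStep {T : Subshift A ℤ} (hT : IsMinimal T)
    (hc : ∀ x ∈ T.carrier, ¬ Computable x) {w : List A} (hw : w ∈ language T)
    (hl : w.length % 2 = 0) (b : Bool) : ∃ u ∈ language T, ∃ m, IsCodingStep w b u m := by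
  obtain ⟨x, hx, hxw, m, hm, hb⟩ := hT.exists_mismatch_order hc hw
    (R := w.length / 2) (by omega) b
  refine ⟨window x (w.length / 2 + 2 * m + 1), word_mem_language hx _ _, m, by simp [window], ?_,
    isFirstWordMismatch_window.2 hm, mismatchBit_window.trans hb⟩
  conv_rhs => rw [← hxw]
  refine List.ext_getElem? fun i => ?_
  rw [List.getElem?_take, List.getElem?_drop]
  split_ifs with hi
  · rw [getElem?_word _ _ hi, window, getElem?_word _ _ (by omega)]
    congr 2
    push_cast
    ring
  · rw [List.getElem?_eq_none (by simpa using hi)]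

/-- A minimal subshift without computable points has points of each degree above that of its
language. -/
theorem IsMinimal.exists_degree_eq {T : Subshift A ℤ} (hT : IsMinimal T)
    (hc : ∀ x ∈ T.carrier, ¬ Computable x) (s : ℕ → Bool)
    (hs : setDegree (language T) ≤ degree s) : ∃ x ∈ T.carrier, degree x = degree s := by
  classical
  obtain ⟨x₀, hx₀⟩ := hT.1
  have : Inhabited A := ⟨x₀ 0⟩
  have hL := (degree_le_degree _ _).1 hs
  have hsO : ComputableIn {codeFun s} s := (degree_le_degree s s).1 le_rfl
  -- The requirement is vacuous for words of odd length or outside the language, so the search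
  -- always ends.
  obtain ⟨g, hg, hgP⟩ : ∃ g : List A × Bool → List A × ℕ, ComputableIn {codeFun s} g ∧
      ∀ q : List A × Bool, q.1 ∈ language T ∧ q.1.length % 2 = 0 →
        (g q).1 ∈ language T ∧ IsCodingStep q.1 q.2 (g q).1 (g q).2 := by
    refine ComputableIn.exists_choice (P := fun (q : List A × Bool) (c : List A × ℕ) =>
      q.1 ∈ language T ∧ q.1.length % 2 = 0 →
      c.1 ∈ language T ∧ IsCodingStep q.1 q.2 c.1 c.2) ?_ fun q => ?_
    · have h1 : ComputableIn {codeFun s} fun v : (List A × Bool) × (List A × ℕ) =>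
          decide (v.1.1 ∈ language T) :=
        hL.comp (Primrec.computableIn (Primrec.fst.comp Primrec.fst))
      have h2 : ComputableIn {codeFun s} fun v : (List A × Bool) × (List A × ℕ) =>
          decide (v.2.1 ∈ language T) :=
        hL.comp (Primrec.computableIn (Primrec.fst.comp Primrec.snd))
      have h3 : ComputableIn {codeFun s} fun v : (List A × Bool) × (List A × ℕ) =>
          decide (v.1.1.length % 2 = 0) :=
        Primrec.computableIn (PrimrecPred.decide (Primrec.eq.comp (Primrec.nat_mod.comp
          (Primrec.list_length.comp (Primrec.fst.comp Primrec.fst)) (Primrec.const 2))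
          (Primrec.const 0)))
      have h4 : ComputableIn {codeFun s} fun v : (List A × Bool) × (List A × ℕ) =>
          decide (IsCodingStep v.1.1 v.1.2 v.2.1 v.2.2) :=
        Primrec.computableIn (PrimrecPred.decide primrec_isCodingStep)
      refine (ComputableIn.cond h1 (ComputableIn.cond h3 (ComputableIn.cond h2 h4
        (ComputableIn.const false)) (ComputableIn.const true)) (ComputableIn.const true)).of_eq
        fun v => ?_
      by_cases a1 : v.1.1 ∈ language T <;> by_cases a2 : v.2.1 ∈ language T <;>
        by_cases a3 : v.1.1.length % 2 = 0 <;> simp [a1, a2, a3]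
    · by_cases h : q.1 ∈ language T ∧ q.1.length % 2 = 0
      · obtain ⟨u, hu, m, hm⟩ := hT.exists_isCodingStep hc h.1 h.2 q.2
        exact ⟨(u, m), fun _ => ⟨hu, hm⟩⟩
      · exact ⟨default, fun h' => absurd h' h⟩
  obtain ⟨W, hWc, hW0, hWs⟩ : ∃ W : ℕ → List A, ComputableIn {codeFun s} W ∧ W 0 = [] ∧
      ∀ i, W (i + 1) = (g (W i, s i)).1 :=
    ⟨fun i => Nat.rec [] (fun i w => (g (w, s i)).1) i,
      ComputableIn.nat_rec (f := fun i : ℕ => i) (g := fun _ => [])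
        (h := fun _ q => (g (q.2, s q.1)).1) ComputableIn.id (ComputableIn.const _)
        (ComputableIn.fst.comp (hg.comp (ComputableIn.pair
          (Primrec.computableIn (Primrec.snd.comp Primrec.snd))
          (hsO.comp (Primrec.computableIn (Primrec.fst.comp Primrec.snd)))))), rfl, fun _ => rfl⟩
  obtain ⟨R, hR⟩ : ∃ R : ℕ → ℕ, ∀ i, R i = (W i).length / 2 := ⟨_, fun _ => rfl⟩
  obtain ⟨M, hM⟩ : ∃ M : ℕ → ℕ, ∀ i, M i = (g (W i, s i)).2 := ⟨_, fun _ => rfl⟩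
  have hinv : ∀ i, W i ∈ language T ∧ (W i).length % 2 = 0 := by
    intro i
    induction i with
    | zero => rw [hW0]; exact ⟨word_mem_language hx₀ 0 0, rfl⟩
    | succ i ih =>
      obtain ⟨h1, h2, -⟩ := hgP (W i, s i) ih
      rw [hWs]
      refine ⟨h1, ?_⟩
      rw [h2]
      omega
  have hstep : ∀ i, IsCodingStep (W i) (s i) (W (i + 1)) (M i) := fun i => by
    rw [hWs, hM]
    exact (hgP (W i, s i) (hinv i)).2
  have hlen : ∀ i, (W i).length = 2 * R i := fun i => by
    have := (hinv i).2
    rw [hR]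
    omega
  have hRs : ∀ i, R (i + 1) = R i + 2 * M i + 1 := fun i => by
    have h := (hstep i).1
    rw [hlen (i + 1), ← hR] at h
    exact Nat.eq_of_mul_eq_mul_left two_pos h
  -- The summand `1` in the radius forces growth whatever the mismatch is, so the words exhaust `ℤ`.
  have hRi : ∀ i, i ≤ R i := by
    intro i
    induction i with
    | zero => exact Nat.zero_le _
    | succ i ih => rw [hRs]; omega
  have hcompat : ∀ (z : ℤ) (i i' : ℕ), i ≤ i' → -(R i : ℤ) ≤ z → z < R i →
      (W i')[(z + R i').toNat]? = (W i)[(z + R i).toNat]? := by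
    intro z i i' hi h1 h2
    induction i', hi using Nat.le_induction with
    | base => rfl
    | succ n hn ih =>
      have hmono : R i ≤ R n := monotone_nat_of_le_succ (fun j => by rw [hRs]; omega) hn
      rw [← ih]
      have h3 : W n = ((W (n + 1)).drop (2 * M n + 1)).take (2 * R n) := by
        rw [hR]
        exact (hstep n).2.1.symm
      conv_rhs => rw [h3]
      rw [List.getElem?_take, if_pos (by omega), List.getElem?_drop, hRs]
      congr 1
      push_cast
      omega
  obtain ⟨y, hy⟩ : ∃ y : ℤ → A, ∀ z, y z =
      (W (z.natAbs + 1))[(z + R (z.natAbs + 1)).toNat]?.getD default := ⟨_, fun _ => rfl⟩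
  have hyW : ∀ (z : ℤ) (i : ℕ), -(R i : ℤ) ≤ z → z < R i →
      (W i)[(z + R i).toNat]? = some (y z) := by
    intro z i h1 h2
    have h3 := hRi (z.natAbs + 1)
    have h4 : (W i)[(z + R i).toNat]? = (W (z.natAbs + 1))[(z + R (z.natAbs + 1)).toNat]? := by
      rcases le_total i (z.natAbs + 1) with h | h
      · exact (hcompat z _ _ h h1 h2).symm
      · exact hcompat z _ _ h (by omega) (by omega)
    have h5 := hlen i
    rw [List.getElem?_eq_getElem (by omega)] at h4 ⊢
    rw [hy, ← h4, Option.getD_some]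
  have hwin : ∀ i, window y (R i) = W i := by
    intro i
    refine List.ext_getElem? fun j => ?_
    by_cases hj : j < 2 * R i
    · rw [window, getElem?_word _ _ hj, ← hyW _ i (by omega) (by omega)]
      congr 1
      omega
    · rw [List.getElem?_eq_none (by simp only [window, length_word]; omega),
        List.getElem?_eq_none (by rw [hlen]; omega)]
  have hyT : y ∈ T.carrier := mem_carrier_of_word_mem_language T fun n =>
    ⟨R n, hRi n, by rw [show word y (-(R n : ℤ)) (2 * R n) = W n from hwin n]; exact (hinv n).1⟩
  have hfirst : ∀ i, IsFirstMismatch y (R i) (M i) := fun i => by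
    have h := (hstep i).2.2.1
    rw [← hwin (i + 1), hRs, ← hR] at h
    exact isFirstWordMismatch_window.1 h
  have hbit : ∀ i, mismatchBit (window y (R i + 2 * M i + 1)) (M i) = s i := fun i => by
    rw [← hRs, hwin]
    exact (hstep i).2.2.2
  refine ⟨y, hyT, (degree_eq_degree y s).2 ⟨?_, ?_⟩⟩
  · have habs : Primrec fun z : ℤ => z.natAbs + 1 :=
      (Primrec.succ.comp (Primrec.nat_add.comp primrec_int_toNat primrec_int_neg_toNat)).of_eq
        fun z => by omega
    have hlook : Primrec fun q : ℤ × List A =>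
        q.2[(q.1 + (q.2.length / 2 : ℕ)).toNat]?.getD default :=
      Primrec.option_getD.comp (Primrec.list_getElem?.comp Primrec.snd
        (primrec_int_toNat.comp (primrec_int_add.comp Primrec.fst (primrec_natCast_int.comp
          (Primrec.nat_div.comp (Primrec.list_length.comp Primrec.snd) (Primrec.const 2))))))
        (Primrec.const _)
    exact (hlook.computableIn.comp (ComputableIn.pair ComputableIn.id
      (hWc.comp habs.computableIn))).of_eq fun z => by rw [hy, hR]; rfl
  · have hyO : ComputableIn {codeFun y} y := (degree_le_degree y y).1 le_rfl
    have hwinO := computableIn_window hyO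
    have hext : Primrec fun q : ℕ × ℕ => q.1 + 2 * q.2 + 1 :=
      Primrec.succ.comp (Primrec.nat_add.comp Primrec.fst
        (Primrec.nat_mul.comp (Primrec.const 2) Primrec.snd))
    -- The decoder searches for the first mismatch at any radius, not only at the radii `R i`, so
    -- `f` is total.
    obtain ⟨f, hf, hfP⟩ : ∃ f : ℕ → ℕ, ComputableIn {codeFun y} f ∧
        ∀ n, IsFirstWordMismatch (window y (n + 2 * f n + 1)) n (f n) := by
      refine ComputableIn.exists_choice
        (P := fun n m => IsFirstWordMismatch (window y (n + 2 * m + 1)) n m) ?_ fun n => ?_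
      · have h1 : ComputableIn {codeFun y} fun v : List A × ℕ × ℕ =>
            decide (IsFirstWordMismatch v.1 v.2.1 v.2.2) :=
          Primrec.computableIn (PrimrecPred.decide primrec_isFirstWordMismatch)
        have h2 : ComputableIn {codeFun y} fun q : ℕ × ℕ => window y (q.1 + 2 * q.2 + 1) :=
          hwinO.comp hext.computableIn
        exact ComputableIn.comp (g := fun q : ℕ × ℕ => (window y (q.1 + 2 * q.2 + 1), q)) h1
          (h2.pair ComputableIn.id)
      · obtain ⟨m, hm⟩ := hT.exists_isFirstMismatch hc hyT n
        exact ⟨m, isFirstWordMismatch_window.2 hm⟩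
    -- First mismatches are unique, so the decoder finds the one used in the construction, and with
    -- it the next radius.
    have hfM : ∀ i, f (R i) = M i := fun i =>
      (isFirstWordMismatch_window.1 (hfP (R i))).unique (hfirst i)
    have hRc : ComputableIn {codeFun y} R := by
      have hrec : ComputableIn {codeFun y} fun i : ℕ =>
          (Nat.rec 0 (fun _ r => r + 2 * f r + 1) i : ℕ) :=
        ComputableIn.nat_rec (f := fun i : ℕ => i) (g := fun _ => 0)
          (h := fun _ q => q.2 + 2 * f q.2 + 1) ComputableIn.id (ComputableIn.const _)
          (hext.computableIn.comp (ComputableIn.pair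
            (Primrec.computableIn (Primrec.snd.comp Primrec.snd))
            (hf.comp (Primrec.computableIn (Primrec.snd.comp Primrec.snd)))))
      refine hrec.of_eq fun i => ?_
      induction i with
      | zero => simp [hR, hW0]
      | succ i ih => rw [hRs, ← hfM, ← ih]
    have hMc : ComputableIn {codeFun y} M := (hf.comp hRc).of_eq hfM
    exact (ComputableIn.comp primrec_mismatchBit.computableIn₂ (ComputableIn.pair
      (hwinO.comp (hext.computableIn.comp (ComputableIn.pair hRc hMc))) hMc)).of_eq hbit

end Degree

end EffSubshift

theorem mainTheorem12 {A : Type*} [Finite A] [Primcodable A] [TopologicalSpace A]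
    [DiscreteTopology A] (S : SymbolicDynamics.FullShift.Subshift A ℤ)
    (hS : S.carrier.Nonempty) (heff : EffSubshift.IsEffective S) :
    (∃ T : SymbolicDynamics.FullShift.Subshift A ℤ,
      T.carrier ⊆ S.carrier ∧ EffSubshift.IsMinimal T ∧
        EffSubshift.setDegree (EffSubshift.language T) ≤ EffSubshift.zeroJump) ∧
    ((∀ x ∈ S.carrier, ¬ Computable x) →
      ∀ s : ℕ → Bool, EffSubshift.zeroJump ≤ EffSubshift.degree s →
        ∃ x ∈ S.carrier, EffSubshift.degree x = EffSubshift.degree s) := by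
  obtain ⟨T, hTS, hT, hL⟩ := EffSubshift.exists_minimal_language_le S hS heff
  refine ⟨⟨T, hTS, hT, hL⟩, fun hc s hs => ?_⟩
  obtain ⟨x, hx, h⟩ := hT.exists_degree_eq (fun x hx => hc x (hTS hx)) s (hL.trans hs)
  exact ⟨x, hTS hx, h⟩
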